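/- Let $n\ge j\ge 1$ be integers and let ${\bf I}=[-1,1]$. Let $\mathcal K_{n,j}$ be the space of smooth embeddings $f:\mathbb R^j\to\mathbb R^n$ with $f(t_1,\dots,t_j)=(t_1,\dots,t_j,0,\dots,0)$ for $(t_1,\dots,t_j)\notin{\bf I}^j$ and $f(\mathbb R^j)\cap\partial{\bf I}^n=\partial{\bf I}^j\times\{0\}^{n-j}$, with the weak $C^\infty$-topology (uniform convergence of all derivatives on compact sets), based at the standard inclusion. Let $V_{n,j}$ be the Stiefel manifold of $j$-tuples of linearly independent vectors in $\mathbb R^n$, based at the standard frame $(e_1,\dots,e_j)$. For a based space $X$ let $\Omega^jX$ be the space of continuous maps $\mathbb R^j\to X$ that send $\mathbb R^j\setminus{\bf I}^j$ to the base point, with the compact-open topology. Let $$SH:\mathcal K_{n,j}\to\Omega^jV_{n,j},\qquad SH(f)(x)=\Bigl(\tfrac{\partial f}{\partial x_1}(x),\dots,\tfrac{\partial f}{\partial x_j}(x)\Bigr)$$ be the Smale--Hirsch map, and let $i:V_{n-1,j-1}\to V_{n,j}$, $(v_1,\dots,v_{j-1})\mapsto(e_1,(0,v_1),\dots,(0,v_{j-1}))$,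 be the fibre inclusion of the Stiefel fibration $V_{n-1,j-1}\to V_{n,j}\to S^{n-1}$ given by the direction of the first vector. Then $SH$ factors up to homotopy through $\Omega^j(i)$: there is a continuous map $g:\mathcal K_{n,j}\to\Omega^jV_{n-1,j-1}$, sending the standard inclusion to the constant loop, such that $SH$ is homotopic to $\Omega^j(i)\circ g$, relative to the base point of $\mathcal K_{n,j}$. In particular, for $j=1$ the map $SH:\mathcal K_{n,1}\to\Omega V_{n,1}$ is null-homotopic (relative to the base point). -/

import Mathlib

open scoped ContDiff Topology

namespace SmaleHirsch

noncomputable section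

/-- The cube `I^n = [-1,1]^n` in `ℝ^n`. -/
def cube (n : ℕ) : Set (Fin n → ℝ) := Set.Icc (-1) 1

/-- The standard linear inclusion `ℝ^j → ℝ^n`, `(t_1,…,t_j) ↦ (t_1,…,t_j,0,…,0)` (used for `j ≤ n`). -/
def stdIncl (n j : ℕ) (t : Fin j → ℝ) : Fin n → ℝ :=
  fun i => if h : (i : ℕ) < j then t ⟨i, h⟩ else 0

/-- A long embedding `ℝ^j → ℝ^n`: a smooth embedding (smooth, a homeomorphism onto its image,
an immersion) which is the standard inclusion outside the cube `I^j` and whose image meets the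
boundary of the cube `I^n` exactly in `∂I^j × {0}`. The type of these is the space `K_{n,j}`. -/
structure LongEmbedding (n j : ℕ) where
  toFun : (Fin j → ℝ) → (Fin n → ℝ)
  smooth : ContDiff ℝ ∞ toFun
  embedding : Topology.IsEmbedding toFun
  immersion : ∀ x, Function.Injective (fderiv ℝ toFun x)
  eq_std : ∀ t, t ∉ cube j → toFun t = stdIncl n j t
  boundary : Set.range toFun ∩ frontier (cube n) = stdIncl n j '' frontier (cube j)

/-- The `k`-th derivative of a long embedding, as a continuous map. -/
def LongEmbedding.derivMap {n j : ℕ} (k : ℕ) (f : LongEmbedding n j) :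
    C(Fin j → ℝ, ContinuousMultilinearMap ℝ (fun _ : Fin k => (Fin j → ℝ)) (Fin n → ℝ)) where
  toFun := iteratedFDeriv ℝ k f.toFun
  continuous_toFun := f.smooth.continuous_iteratedFDeriv (by exact_mod_cast le_top)

/-- The weak `C^∞` topology: uniform convergence on compact sets of all derivatives (including the
`0`-th one), that is, the coarsest topology for which all the maps `f ↦ D^k f` into spaces of
continuous maps with the compact-open topology are continuous. -/
instance (n j : ℕ) : TopologicalSpace (LongEmbedding n j) :=
  ⨅ k : ℕ, TopologicalSpace.induced (LongEmbedding.derivMap k) inferInstance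

/-- The Stiefel manifold `V_{n,j}` of `j`-tuples of linearly independent vectors in `ℝ^n`,
topologized as a subspace of `(ℝ^n)^j`. -/
abbrev Stiefel (n j : ℕ) : Type := {v : Fin j → (Fin n → ℝ) // LinearIndependent ℝ v}

/-- The `j`-fold loop space `Ω^j X` of `X` at `x₀`: continuous maps `ℝ^j → X` that are constant
with value `x₀` outside `I^j`, with the compact-open topology. -/
abbrev LoopSpace (j : ℕ) (X : Type) [TopologicalSpace X] (x₀ : X) : Type :=
  {γ : C(Fin j → ℝ, X) // ∀ t, t ∉ cube j → γ t = x₀}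

/-- The constant loop, the base point of `Ω^j X`. -/
def constLoop (j : ℕ) {X : Type} [TopologicalSpace X] (x₀ : X) : LoopSpace j X x₀ :=
  ⟨ContinuousMap.const _ x₀, fun _ _ => rfl⟩

/-- The `j`-fold loop `Ω^j φ` of a based map `φ`, given by postcomposition. -/
def loopMap (j : ℕ) {X Y : Type} [TopologicalSpace X] [TopologicalSpace Y] {x₀ : X} {y₀ : Y}
    (φ : C(X, Y)) (hφ : φ x₀ = y₀) : C(LoopSpace j X x₀, LoopSpace j Y y₀) where
  toFun γ := ⟨φ.comp γ.1, fun t ht => by simp [γ.2 t ht, hφ]⟩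
  continuous_toFun :=
    ((ContinuousMap.continuous_postcomp φ).comp continuous_subtype_val).subtype_mk _

/-! ### The standard frame and the standard embedding -/

theorem stdIncl_add (n j : ℕ) (s t : Fin j → ℝ) :
    stdIncl n j (s + t) = stdIncl n j s + stdIncl n j t := by
  funext i
  by_cases h : (i : ℕ) < j <;> simp [stdIncl, h]

theorem stdIncl_smul (n j : ℕ) (c : ℝ) (t : Fin j → ℝ) :
    stdIncl n j (c • t) = c • stdIncl n j t := by
  funext i
  by_cases h : (i : ℕ) < j <;> simp [stdIncl, h]

/-- The standard inclusion as a continuous linear map. -/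
def stdInclL (n j : ℕ) : (Fin j → ℝ) →L[ℝ] (Fin n → ℝ) :=
  LinearMap.toContinuousLinearMap
    { toFun := stdIncl n j, map_add' := stdIncl_add n j, map_smul' := stdIncl_smul n j }

theorem coe_stdInclL (n j : ℕ) : ⇑(stdInclL n j) = stdIncl n j := rfl

theorem stdIncl_castLE {n j : ℕ} (h : j ≤ n) (t : Fin j → ℝ) (k : Fin j) :
    stdIncl n j t (Fin.castLE h k) = t k := by
  simp [stdIncl]

theorem stdIncl_injective {n j : ℕ} (h : j ≤ n) : Function.Injective (stdIncl n j) := by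
  intro s t hst
  funext k
  rw [← stdIncl_castLE h s k, hst, stdIncl_castLE h t k]

theorem norm_stdIncl {n j : ℕ} (h : j ≤ n) (t : Fin j → ℝ) : ‖stdIncl n j t‖ = ‖t‖ := by
  apply le_antisymm
  · refine (pi_norm_le_iff_of_nonneg (norm_nonneg _)).2 fun i => ?_
    by_cases hi : (i : ℕ) < j
    · simpa [stdIncl, hi] using norm_le_pi_norm t ⟨i, hi⟩
    · simp [stdIncl, hi]
  · refine (pi_norm_le_iff_of_nonneg (norm_nonneg _)).2 fun k => ?_
    rw [← stdIncl_castLE h t k]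
    exact norm_le_pi_norm _ _

theorem frontier_cube (n : ℕ) : frontier (cube n) = {x | ‖x‖ = 1} := by
  have : cube n = Metric.closedBall 0 1 := by
    ext x
    simp only [cube, Set.mem_Icc, mem_closedBall_zero_iff,
      pi_norm_le_iff_of_nonneg (zero_le_one' ℝ), Real.norm_eq_abs, abs_le, Pi.le_def,
      Pi.neg_apply, Pi.one_apply, forall_and]
  rw [this, frontier_closedBall _ one_ne_zero]
  ext x
  simp

/-- The standard frame `(e_1,…,e_j)`, the base point of `V_{n,j}`. -/
def stdFrame {n j : ℕ} (h : j ≤ n) : Stiefel n j :=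
  ⟨fun k => stdIncl n j (Pi.single k 1), by
    have hb : LinearIndependent ℝ (fun k : Fin j => (Pi.single k (1 : ℝ) : Fin j → ℝ)) := by
      convert (Pi.basisFun ℝ (Fin j)).linearIndependent using 1
      funext k
      simp
    exact hb.map' (stdInclL n j).toLinearMap
      (LinearMap.ker_eq_bot.2 (stdIncl_injective h))⟩

/-- The standard inclusion as a long embedding, the base point of `K_{n,j}`. -/
def LongEmbedding.std {n j : ℕ} (h : j ≤ n) : LongEmbedding n j where
  toFun := stdIncl n j
  smooth := (stdInclL n j).contDiff
  embedding := by
    refine Topology.IsEmbedding.of_leftInverse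
      (f := fun (y : Fin n → ℝ) (k : Fin j) => y (Fin.castLE h k)) ?_ ?_ ?_
    · exact fun t => funext fun k => stdIncl_castLE h t k
    · fun_prop
    · exact (stdInclL n j).continuous
  immersion x := by
    rw [← coe_stdInclL, ContinuousLinearMap.fderiv]
    exact stdIncl_injective h
  eq_std _ _ := rfl
  boundary := by
    ext y
    simp only [frontier_cube]
    constructor
    · rintro ⟨⟨t, rfl⟩, ht⟩
      exact ⟨t, (norm_stdIncl h t).symm.trans ht, rfl⟩
    · rintro ⟨t, ht, rfl⟩
      exact ⟨⟨t, rfl⟩, (norm_stdIncl h t).trans ht⟩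

/-! ### The Smale-Hirsch map -/

/-- The frame `(∂f/∂x_1,…,∂f/∂x_j)` of a long embedding `f` at a point. -/
def LongEmbedding.frame {n j : ℕ} (f : LongEmbedding n j) (x : Fin j → ℝ) : Stiefel n j :=
  ⟨fun k => fderiv ℝ f.toFun x (Pi.single k 1), by
    have hb : LinearIndependent ℝ (fun k : Fin j => (Pi.single k (1 : ℝ) : Fin j → ℝ)) := by
      convert (Pi.basisFun ℝ (Fin j)).linearIndependent using 1
      funext k
      simp
    exact hb.map' (fderiv ℝ f.toFun x).toLinearMap
      (LinearMap.ker_eq_bot.2 (f.immersion x))⟩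

/-- The map `x ↦ (∂f/∂x_1,…,∂f/∂x_j)(x)` as an element of `Ω^j V_{n,j}`. -/
def LongEmbedding.frameLoop {n j : ℕ} (h : j ≤ n) (f : LongEmbedding n j) :
    LoopSpace j (Stiefel n j) (stdFrame h) :=
  ⟨⟨f.frame, by
      refine Continuous.subtype_mk ?_ _
      have := f.smooth.continuous_fderiv (by simp)
      fun_prop⟩, by
    intro t ht
    have hev : f.toFun =ᶠ[𝓝 t] stdInclL n j := by
      have ho : (cube j)ᶜ ∈ 𝓝 t := isClosed_Icc.isOpen_compl.mem_nhds ht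
      filter_upwards [ho] with s hs using f.eq_std s hs
    apply Subtype.ext
    funext k
    change fderiv ℝ f.toFun t (Pi.single k 1) = stdIncl n j (Pi.single k 1)
    rw [hev.fderiv_eq, ContinuousLinearMap.fderiv, coe_stdInclL]⟩

theorem continuous_derivMap (n j k : ℕ) :
    Continuous (LongEmbedding.derivMap k : LongEmbedding n j → _) :=
  continuous_iInf_dom continuous_induced_dom

/-- The Smale-Hirsch map `SH : K_{n,j} → Ω^j V_{n,j}`, `f ↦ (∂f/∂x_1,…,∂f/∂x_j)`. -/
def smaleHirsch {n j : ℕ} (h : j ≤ n) :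
    C(LongEmbedding n j, LoopSpace j (Stiefel n j) (stdFrame h)) where
  toFun f := f.frameLoop h
  continuous_toFun := by
    refine Continuous.subtype_mk ?_ _
    have hval : Topology.IsInducing
        (ContinuousMap.comp (⟨Subtype.val, continuous_subtype_val⟩ :
          C(Stiefel n j, Fin j → (Fin n → ℝ))) : C(Fin j → ℝ, Stiefel n j) → _) :=
      ContinuousMap.isInducing_postcomp _ Topology.IsInducing.subtypeVal
    rw [hval.continuous_iff]
    let ev : C(ContinuousMultilinearMap ℝ (fun _ : Fin 1 => (Fin j → ℝ)) (Fin n → ℝ),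
        Fin j → (Fin n → ℝ)) :=
      ⟨fun m k => m (fun _ => Pi.single k 1), by fun_prop⟩
    have := (ContinuousMap.continuous_postcomp (X := Fin j → ℝ) ev).comp
      (continuous_derivMap n j 1)
    convert this using 1
    funext f
    ext x k i
    change fderiv ℝ f.toFun x (Pi.single k 1) i =
      iteratedFDeriv ℝ 1 f.toFun x (fun _ => Pi.single k 1) i
    rw [iteratedFDeriv_one_apply]

/-! ### The fibre inclusion -/

/-- The fibre inclusion `i : V_{n,j} → V_{n+1,j+1}` of the fibration
`V_{n,j} → V_{n+1,j+1} → S^n` (direction of the first vector) over `e_1`: it sends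
`(v_1,…,v_j)` to `(e_1,(0,v_1),…,(0,v_j))`. It identifies `V_{n,j}` with the frames whose first vector
is `e_1` and whose other vectors are orthogonal to `e_1`; on orthonormal frames this is exactly
the fibre, and on linearly independent frames it is a deformation retract of the fibre. -/
def fibreIncl (n j : ℕ) : C(Stiefel n j, Stiefel (n + 1) (j + 1)) where
  toFun v := ⟨Fin.cons (Pi.single 0 1) fun k => Fin.cons 0 (v.1 k), by
    rw [Fintype.linearIndependent_iff]
    intro c hc
    rw [Fin.sum_univ_succ] at hc
    simp only [Fin.cons_zero, Fin.cons_succ] at hc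
    have h0 : c 0 = 0 := by simpa using congrFun hc 0
    have hs : ∀ k : Fin j, c k.succ = 0 := by
      refine Fintype.linearIndependent_iff.1 v.2 (fun k => c k.succ) ?_
      funext i
      simpa using congrFun hc i.succ
    exact fun k => Fin.cases h0 hs k⟩
  continuous_toFun := by
    refine Continuous.subtype_mk ?_ _
    refine continuous_pi fun k => Fin.cases ?_ (fun k => ?_) k
    · simpa using continuous_const
    · simp only [Fin.cons_succ]
      refine continuous_pi fun i => Fin.cases ?_ (fun i => ?_) i
      · simpa using continuous_const
      · simp only [Fin.cons_succ]
        exact (continuous_apply i).comp ((continuous_apply k).comp continuous_subtype_val)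

theorem fibreIncl_stdFrame {n j : ℕ} (h : j ≤ n) :
    fibreIncl n j (stdFrame h) = stdFrame (Nat.add_le_add_right h 1) := by
  apply Subtype.ext
  funext k i
  refine Fin.cases ?_ (fun k => ?_) k <;> refine Fin.cases ?_ (fun i => ?_) i
  · simp [fibreIncl, stdFrame, stdIncl]
  · by_cases hi : (i : ℕ) < j
    · simp [fibreIncl, stdFrame, stdIncl, hi, Fin.ext_iff]
    · simp [fibreIncl, stdFrame, stdIncl, hi]
  · simp [fibreIncl, stdFrame, stdIncl, Fin.ext_iff]
  · by_cases hi : (i : ℕ) < j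
    · simp [fibreIncl, stdFrame, stdIncl, hi, Pi.single_apply, Fin.ext_iff]
    · simp [fibreIncl, stdFrame, stdIncl, hi]

end

end SmaleHirsch

/-!
For `a < b` let `W(a, b)` be the difference quotient of the long embedding `f` between the points
with first coordinates `a` and `b` on a line parallel to `e₁`, and let `W(a, a) = ∂f/∂x₁`
(`LongEmbedding.secant`). It is never zero, because `f` is injective and an immersion. Hence
`∂f/∂x₁`, which is `W` on the diagonal of the triangle `-1 ≤ a ≤ b ≤ 1`, can be deformed through
nonzero vectors into `W` along the edges `a = -1` and `b = 1`, with the ends of the diagonal fixed.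
The condition on the boundary makes `f` map the cube into the cube
(`LongEmbedding.norm_apply_lt_one`), so that on these two edges `W` has nonnegative first
coordinate, and a straight line homotopy leads to `e₁`. The whole deformation
(`LongEmbedding.secantPath`) is constant outside the cube and on the standard embedding.

It remains to lift it to frames, starting with the Smale-Hirsch map. The fibration of frames over
nonzero vectors is lifted by hand, over any parameter space, in `exists_frame_lift`: if
`⟨u, v⟩ > 0` then `x ↦ x + (⟨u, x⟩ / ⟨u, u⟩) (v - u)` is an isomorphism taking `u` to `v`, and it is
the identity for `u = v`; a path of nonzero vectors is followed by finitely many such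
isomorphisms, with a step size that depends continuously on the path (`exists_continuous_step`).
At the end of the lift the first vector is `e₁`, and subtracting from the other vectors their
components along `e₁` moves the frames into the image of `V_{n-1,j-1}` (`straighten_one`).
-/

namespace SmaleHirsch

noncomputable section

/-! ### Moving the first vector of a frame -/

/-- The linear map `x ↦ x + (⟨u, x⟩ / ⟨u, u⟩) (v - u)`. It sends `u` to `v` and fixes the orthogonal
complement of `u`; its determinant is `⟨u, v⟩ / ⟨u, u⟩`. -/
def shear {n : ℕ} (u v : Fin n → ℝ) : (Fin n → ℝ) →ₗ[ℝ] (Fin n → ℝ) where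
  toFun x := x + ((u ⬝ᵥ x) / (u ⬝ᵥ u)) • (v - u)
  map_add' x y := by rw [dotProduct_add, add_div, add_smul]; abel
  map_smul' c x := by
    rw [dotProduct_smul, RingHom.id_apply, smul_add, smul_smul, smul_eq_mul, mul_div_assoc]

theorem shear_apply {n : ℕ} (u v x : Fin n → ℝ) :
    shear u v x = x + ((u ⬝ᵥ x) / (u ⬝ᵥ u)) • (v - u) := rfl

theorem shear_apply_self {n : ℕ} {u : Fin n → ℝ} (hu : u ≠ 0) (v : Fin n → ℝ) :
    shear u v u = v := by
  rw [shear_apply, div_self (dotProduct_self_eq_zero.not.2 hu)]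
  simp

theorem shear_self {n : ℕ} (u x : Fin n → ℝ) : shear u u x = x := by simp [shear_apply]

theorem ker_shear {n : ℕ} {u v : Fin n → ℝ} (h : 0 < u ⬝ᵥ v) :
    LinearMap.ker (shear u v) = ⊥ := by
  refine LinearMap.ker_eq_bot'.2 fun x hx => ?_
  have hu : u ⬝ᵥ u ≠ 0 := by
    rw [Ne, dotProduct_self_eq_zero]
    rintro rfl
    simp at h
  have h1 := congrArg (u ⬝ᵥ ·) hx
  simp only [shear_apply, dotProduct_add, dotProduct_smul, dotProduct_sub, smul_eq_mul,
    dotProduct_zero] at h1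
  have h2 : (u ⬝ᵥ x) * (u ⬝ᵥ v) = 0 := by
    field_simp at h1
    linarith
  have h3 : u ⬝ᵥ x = 0 := (mul_eq_zero.1 h2).resolve_right h.ne'
  simpa [shear_apply, h3] using hx

/-- Transport of a tuple `F` of vectors along a path `w` of vectors: after `k` steps of length `δ`,
the path stopping at time `s`, the map `shear (w t) (w t')` having been applied on each step from
`t` to `t'`. -/
def transport {n m : ℕ} (w : ℝ → Fin n → ℝ) (F : Fin m → Fin n → ℝ) (δ s : ℝ) :
    ℕ → Fin m → Fin n → ℝ
  | 0 => F
  | k + 1 => fun i =>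
      shear (w (min (k * δ) s)) (w (min ((k + 1 : ℕ) * δ) s)) (transport w F δ s k i)

theorem transport_succ {n m : ℕ} (w : ℝ → Fin n → ℝ) (F : Fin m → Fin n → ℝ) (δ s : ℝ) (k : ℕ)
    (i : Fin m) : transport w F δ s (k + 1) i =
      shear (w (min (k * δ) s)) (w (min ((k + 1 : ℕ) * δ) s)) (transport w F δ s k i) := rfl

section transport

variable {n m : ℕ} {w : ℝ → Fin n → ℝ} {F : Fin m → Fin n → ℝ} {δ s : ℝ}

theorem min_step_mem (hδ : 0 ≤ δ) (hs : s ∈ Set.Icc (0 : ℝ) 1) (k : ℕ) :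
    min (k * δ) s ∈ Set.Icc (0 : ℝ) 1 :=
  ⟨le_min (by positivity) hs.1, (min_le_right _ _).trans hs.2⟩

theorem transport_eq_of_le (hδ : 0 ≤ δ) {k l : ℕ} (hkl : k ≤ l) (hk : s ≤ k * δ) :
    transport w F δ s l = transport w F δ s k := by
  induction l, hkl using Nat.le_induction with
  | base => rfl
  | succ l hl ih =>
    have h1 : s ≤ l * δ := hk.trans (by gcongr)
    have h2 : s ≤ (l + 1 : ℕ) * δ := h1.trans (by gcongr; simp)
    funext i
    rw [transport_succ, min_eq_right h1, min_eq_right h2, shear_self, ih]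

theorem transport_of_const (hδ : 0 ≤ δ) (hs : s ∈ Set.Icc (0 : ℝ) 1)
    (hw : ∀ t ∈ Set.Icc (0 : ℝ) 1, w t = w 0) (k : ℕ) : transport w F δ s k = F := by
  induction k with
  | zero => rfl
  | succ k ih =>
    funext i
    rw [transport_succ, hw _ (min_step_mem hδ hs k), hw _ (min_step_mem hδ hs (k + 1)), shear_self, ih]

theorem transport_apply_zero {F : Fin (m + 1) → Fin n → ℝ} (hδ : 0 ≤ δ)
    (hs : s ∈ Set.Icc (0 : ℝ) 1)
    (hw : ∀ t ∈ Set.Icc (0 : ℝ) 1, w t ≠ 0) (hF : F 0 = w 0) (k : ℕ) :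
    transport w F δ s k 0 = w (min (k * δ) s) := by
  induction k with
  | zero => simpa [transport, min_eq_left hs.1] using hF
  | succ k ih => rw [transport_succ, ih, shear_apply_self (hw _ (min_step_mem hδ hs k))]

theorem linearIndependent_transport (hδ : 0 ≤ δ) (hs : s ∈ Set.Icc (0 : ℝ) 1)
    (hw : ∀ t ∈ Set.Icc (0 : ℝ) 1, ∀ t' ∈ Set.Icc (0 : ℝ) 1, |t - t'| ≤ δ → 0 < w t ⬝ᵥ w t')
    (hF : LinearIndependent ℝ F) (k : ℕ) : LinearIndependent ℝ (transport w F δ s k) := by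
  induction k with
  | zero => exact hF
  | succ k ih =>
    refine ih.map' _ (ker_shear (hw _ (min_step_mem hδ hs k) _ (min_step_mem hδ hs (k + 1)) ?_))
    refine (abs_min_sub_min_le_max _ _ _ _).trans ?_
    push_cast
    rw [show (k : ℝ) * δ - (k + 1) * δ = -δ by ring, sub_self, abs_neg, abs_of_nonneg hδ, abs_zero,
      max_eq_left hδ]

end transport

/-- A continuous family of nowhere vanishing paths admits a step size that varies continuously
and is small enough for all steps of this size to have positive inner product. It is half the
minimum over all pairs `(t, t')` of `|t - t'| + max 0 ⟨w t, w t'⟩`. -/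
theorem exists_continuous_step {Z : Type*} [TopologicalSpace Z] {n : ℕ}
    {w : Z → ℝ → Fin n → ℝ} (hw : Continuous fun p : Z × ℝ => w p.1 p.2)
    (hw0 : ∀ z, ∀ t ∈ Set.Icc (0 : ℝ) 1, w z t ≠ 0) :
    ∃ δ : Z → ℝ, Continuous δ ∧ (∀ z, 0 < δ z) ∧
      ∀ z, ∀ t ∈ Set.Icc (0 : ℝ) 1, ∀ t' ∈ Set.Icc (0 : ℝ) 1, |t - t'| ≤ δ z →
        0 < w z t ⬝ᵥ w z t' := by
  let q : Z → ℝ × ℝ → ℝ := fun z p => |p.1 - p.2| + max 0 (w z p.1 ⬝ᵥ w z p.2)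
  have hq : Continuous (Function.uncurry q) := by
    have h1 : Continuous fun p : Z × ℝ × ℝ => w p.1 p.2.1 :=
      hw.comp (f := fun p : Z × ℝ × ℝ => (p.1, p.2.1)) (by fun_prop)
    have h2 : Continuous fun p : Z × ℝ × ℝ => w p.1 p.2.2 :=
      hw.comp (f := fun p : Z × ℝ × ℝ => (p.1, p.2.2)) (by fun_prop)
    change Continuous fun p : Z × ℝ × ℝ =>
      |p.2.1 - p.2.2| + max 0 (w p.1 p.2.1 ⬝ᵥ w p.1 p.2.2)
    have h3 := h1.dotProduct h2
    fun_prop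
  let K : Set (ℝ × ℝ) := Set.Icc 0 1 ×ˢ Set.Icc 0 1
  have hK : IsCompact K := isCompact_Icc.prod isCompact_Icc
  have hKne : K.Nonempty := ⟨(0, 0), by simp [K]⟩
  have key : ∀ z, ∃ x ∈ K, sInf (q z '' K) = q z x ∧ ∀ y ∈ K, q z x ≤ q z y := fun z =>
    hK.exists_sInf_image_eq_and_le hKne (hq.uncurry_left z).continuousOn
  have hpos : ∀ z, 0 < sInf (q z '' K) := by
    intro z
    obtain ⟨⟨t, t'⟩, ht, hq1, -⟩ := key z
    rw [hq1]
    rcases eq_or_ne t t' with rfl | hne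
    · have : 0 < w z t ⬝ᵥ w z t := by
        have h0 : 0 ≤ w z t ⬝ᵥ w z t := by
          simpa using dotProduct_star_self_nonneg (w z t)
        exact lt_of_le_of_ne h0 (Ne.symm (dotProduct_self_eq_zero.not.2 (hw0 z t ht.1)))
      exact add_pos_of_nonneg_of_pos (abs_nonneg _) (lt_max_of_lt_right this)
    · exact add_pos_of_pos_of_nonneg (abs_pos.2 (sub_ne_zero.2 hne)) (le_max_left _ _)
  refine ⟨fun z => sInf (q z '' K) / 2, (hK.continuous_sInf hq).div_const 2,
    fun z => half_pos (hpos z), fun z t ht t' ht' hd => ?_⟩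
  obtain ⟨x, -, hx, hle⟩ := key z
  have h1 := hle (t, t') ⟨ht, ht'⟩
  rw [← hx] at h1
  have h2 := hpos z
  by_contra hcon
  simp only [q, max_eq_left (not_lt.1 hcon)] at h1
  linarith

theorem continuous_transport {Z : Type*} [TopologicalSpace Z] {n m : ℕ}
    {w : Z → ℝ → Fin n → ℝ} (hw : Continuous fun p : Z × ℝ => w p.1 p.2)
    (hw0 : ∀ z, ∀ t ∈ Set.Icc (0 : ℝ) 1, w z t ≠ 0)
    {F : Z → Fin m → Fin n → ℝ} (hF : Continuous F) {δ : Z → ℝ} (hδ : Continuous δ)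
    (hδ0 : ∀ z, 0 < δ z) (k : ℕ) :
    Continuous fun p : Z × unitInterval => transport (w p.1) (F p.1) (δ p.1) p.2 k := by
  induction k with
  | zero => exact hF.comp continuous_fst
  | succ k ih =>
    have hstep : ∀ l : ℕ, Continuous fun p : Z × unitInterval =>
        w p.1 (min (l * δ p.1) (p.2 : ℝ)) := fun l =>
      hw.comp (f := fun p : Z × unitInterval => (p.1, min (l * δ p.1) (p.2 : ℝ))) (by fun_prop)
    refine continuous_pi fun i => ?_
    have ih' := (continuous_pi_iff.1 ih) i
    simp only [transport_succ, shear_apply]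
    have hc := ((hstep k).dotProduct ih').div ((hstep k).dotProduct (hstep k)) fun p =>
      dotProduct_self_eq_zero.not.2 (hw0 _ _ (min_step_mem (hδ0 _).le p.2.2 k))
    exact ih'.add (hc.smul ((hstep (k + 1)).sub (hstep k)))

/-- Lifting of a homotopy of nonzero vectors, over an arbitrary parameter space, to a homotopy of
frames with prescribed initial frame. The lift is constant on the parameters at which the given
homotopy is constant. -/
theorem exists_frame_lift {Z : Type*} [TopologicalSpace Z] {n m : ℕ}
    {w : Z → ℝ → Fin n → ℝ} (hw : Continuous fun p : Z × ℝ => w p.1 p.2)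
    (hw0 : ∀ z, ∀ t ∈ Set.Icc (0 : ℝ) 1, w z t ≠ 0)
    {F : Z → Stiefel n (m + 1)} (hF : Continuous F) (hFw : ∀ z, (F z).1 0 = w z 0) :
    ∃ G : Z × unitInterval → Stiefel n (m + 1), Continuous G ∧ (∀ z, G (z, 0) = F z) ∧
      (∀ z s, (G (z, s)).1 0 = w z s) ∧
      ∀ z, (∀ t ∈ Set.Icc (0 : ℝ) 1, w z t = w z 0) → ∀ s, G (z, s) = F z := by
  obtain ⟨δ, hδ, hδ0, hpos⟩ := exists_continuous_step hw hw0
  have hle : ∀ (z : Z) (s : unitInterval), (s : ℝ) ≤ ⌈1 / δ z⌉₊ * δ z := fun z s =>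
    s.2.2.trans ((div_le_iff₀ (hδ0 z)).1 (Nat.le_ceil _))
  refine ⟨fun p => ⟨transport (w p.1) (F p.1).1 (δ p.1) p.2 ⌈1 / δ p.1⌉₊,
    linearIndependent_transport (hδ0 _).le p.2.2 (hpos p.1) (F p.1).2 _⟩, ?_, ?_, ?_, ?_⟩
  · refine Continuous.subtype_mk (continuous_iff_continuousAt.2 fun p => ?_) _
    -- Near `p` the step size exceeds half its value at `p`, so a fixed number of steps suffices.
    have hnear : ∀ᶠ p' : Z × unitInterval in 𝓝 p, δ p.1 / 2 < δ p'.1 :=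
      (hδ.comp continuous_fst).continuousAt.eventually_const_lt (half_lt_self (hδ0 p.1))
    refine (continuous_transport hw hw0 (continuous_subtype_val.comp hF) hδ hδ0
      ⌈1 / (δ p.1 / 2)⌉₊).continuousAt.congr ?_
    filter_upwards [hnear] with p' hp'
    refine transport_eq_of_le (hδ0 _).le ?_ (hle p'.1 p'.2)
    exact Nat.ceil_mono (one_div_le_one_div_of_le (half_pos (hδ0 p.1)) hp'.le)
  · intro z
    exact Subtype.ext (transport_eq_of_le (hδ0 z).le (Nat.zero_le _) (by simp))
  · intro z s
    change transport _ _ _ _ _ 0 = _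
    rw [transport_apply_zero (hδ0 z).le s.2 (hw0 z) (hFw z), min_eq_right (hle z s)]
  · intro z hz s
    exact Subtype.ext (transport_of_const (hδ0 z).le s.2 hz _)

/-! ### Long embeddings near the boundary of the cube -/

theorem cube_eq_closedBall (n : ℕ) : cube n = Metric.closedBall 0 1 := by
  ext x
  simp only [cube, Set.mem_Icc, mem_closedBall_zero_iff,
    pi_norm_le_iff_of_nonneg (zero_le_one' ℝ), Real.norm_eq_abs, abs_le, Pi.le_def,
    Pi.neg_apply, Pi.one_apply, forall_and]

theorem mem_cube_iff_norm {n : ℕ} {x : Fin n → ℝ} : x ∈ cube n ↔ ‖x‖ ≤ 1 := by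
  rw [cube_eq_closedBall, mem_closedBall_zero_iff]

theorem mem_closure_compl_cube {n : ℕ} {x : Fin n → ℝ} (hx : 1 ≤ ‖x‖) :
    x ∈ closure (cube n)ᶜ := by
  rw [closure_compl, cube_eq_closedBall, interior_closedBall _ one_ne_zero]
  simpa using hx

namespace LongEmbedding

variable {n j : ℕ} (f : LongEmbedding n j)

theorem continuous_fderiv : Continuous (fderiv ℝ f.toFun) :=
  f.smooth.continuous_fderiv (by simp)

theorem differentiable : Differentiable ℝ f.toFun := f.smooth.differentiable (by simp)

theorem apply_of_one_le_norm {x : Fin j → ℝ} (hx : 1 ≤ ‖x‖) : f.toFun x = stdIncl n j x :=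
  Set.EqOn.closure (fun t ht => f.eq_std t ht) f.smooth.continuous (stdInclL n j).continuous
    (mem_closure_compl_cube hx)

theorem fderiv_of_one_le_norm {x : Fin j → ℝ} (hx : 1 ≤ ‖x‖) :
    fderiv ℝ f.toFun x = stdInclL n j := by
  refine Set.EqOn.closure (s := (cube j)ᶜ) (g := fun _ => stdInclL n j) (fun t ht => ?_)
    f.continuous_fderiv continuous_const (mem_closure_compl_cube hx)
  have hev : f.toFun =ᶠ[𝓝 t] stdInclL n j := by
    filter_upwards [isClosed_Icc.isOpen_compl.mem_nhds ht] with s hs using f.eq_std s hs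
  rw [hev.fderiv_eq, ContinuousLinearMap.fderiv]

theorem norm_apply_ne_one {x : Fin j → ℝ} (hx : ‖x‖ < 1) : ‖f.toFun x‖ ≠ 1 := by
  intro h
  have hmem : f.toFun x ∈ Set.range f.toFun ∩ frontier (cube n) :=
    ⟨⟨x, rfl⟩, by rw [frontier_cube]; exact h⟩
  rw [f.boundary, frontier_cube] at hmem
  obtain ⟨t, ht, htx⟩ := hmem
  rw [← f.apply_of_one_le_norm (ge_of_eq ht)] at htx
  rw [f.embedding.injective htx] at ht
  exact hx.ne ht

end LongEmbedding

theorem stdIncl_single_zero (n j : ℕ) (c : ℝ) :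
    stdIncl (n + 1) (j + 1) (Pi.single 0 c) = Pi.single 0 c := by
  funext i
  refine Fin.cases ?_ (fun i => ?_) i
  · simp [stdIncl]
  · by_cases hi : (i : ℕ) < j <;> simp [stdIncl, hi]

namespace LongEmbedding

variable {n j : ℕ} (f : LongEmbedding (n + 1) (j + 1))

/-- Just inside the cube at `-e₁`, a long embedding takes a value in the interior of the cube,
since its value and its derivative at `-e₁` are the standard ones. -/
theorem exists_norm_apply_lt_one : ∃ x, ‖x‖ < 1 ∧ ‖f.toFun x‖ < 1 := by
  let γ : ℝ → Fin (j + 1) → ℝ := fun ε => Pi.single 0 (-1 + ε)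
  have hp : 1 ≤ ‖(Pi.single 0 (-1) : Fin (j + 1) → ℝ)‖ := by
    rw [Pi.norm_single]; simp
  have hγ : HasDerivAt γ (Pi.single 0 1) 0 := by
    have h := ((hasDerivAt_id (0 : ℝ)).const_add (-1)).smul_const
      (Pi.single 0 1 : Fin (j + 1) → ℝ)
    rw [one_smul] at h
    have hγ' : γ = fun ε => (-1 + id ε) • Pi.single 0 1 := by
      funext ε
      simp [γ, ← Pi.single_smul]
    rw [hγ']
    exact h
  have hfγ : HasDerivAt (fun ε => f.toFun (γ ε)) (Pi.single 0 1) 0 := by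
    have h0 : HasFDerivAt f.toFun (stdInclL (n + 1) (j + 1)) (γ 0) := by
      rw [← f.fderiv_of_one_le_norm (x := γ 0) (by simpa [γ] using hp)]
      exact (f.differentiable _).hasFDerivAt
    have h := h0.comp_hasDerivAt (0 : ℝ) hγ
    rwa [coe_stdInclL, stdIncl_single_zero] at h
  have h0 : f.toFun (γ 0) = Pi.single 0 (-1) := by
    rw [f.apply_of_one_le_norm (by simpa [γ] using hp)]
    simp [γ, stdIncl_single_zero]
  rw [hasDerivAt_iff_isLittleO_nhds_zero] at hfγ
  have hb := hfγ.def (c := 1 / 2) (by norm_num)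
  have hb' := hb.filter_mono (nhdsWithin_le_nhds (s := Set.Ioi 0))
  have hlt : ∀ᶠ ε : ℝ in 𝓝[>] 0, ε < 1 :=
    (eventually_lt_nhds one_pos).filter_mono nhdsWithin_le_nhds
  obtain ⟨ε, hε, hε1, hε0⟩ := (hb'.and (hlt.and self_mem_nhdsWithin)).exists
  have hε0 : 0 < ε := hε0
  refine ⟨γ ε, ?_, ?_⟩
  · rw [Pi.norm_single, Real.norm_eq_abs, abs_lt]
    constructor <;> linarith
  · simp only [zero_add, h0] at hε
    have hsplit : f.toFun (γ ε) = (f.toFun (γ ε) - Pi.single 0 (-1) - ε • Pi.single 0 1) +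
        Pi.single 0 (-1 + ε) := by
      rw [Pi.single_add, ← Pi.single_smul]
      simp
    rw [hsplit]
    refine (norm_add_le _ _).trans_lt ?_
    rw [Pi.norm_single, Real.norm_eq_abs, abs_of_neg (by linarith : -1 + ε < 0)]
    rw [Real.norm_eq_abs, abs_of_pos hε0] at hε
    linarith

theorem norm_apply_lt_one {x : Fin (j + 1) → ℝ} (hx : ‖x‖ < 1) : ‖f.toFun x‖ < 1 := by
  obtain ⟨y, hy, hfy⟩ := f.exists_norm_apply_lt_one
  have hpre : IsPreconnected (f.toFun '' Metric.ball 0 1) :=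
    (convex_ball _ _).isPreconnected.image _ f.smooth.continuous.continuousOn
  have hsub := hpre.subset_left_of_subset_union (u := {z | ‖z‖ < 1}) (v := {z | 1 < ‖z‖})
    (isOpen_lt continuous_norm continuous_const) (isOpen_lt continuous_const continuous_norm)
    (Set.disjoint_left.2 fun z (hz : ‖z‖ < 1) (hz' : 1 < ‖z‖) => lt_asymm hz hz')
    (Set.image_subset_iff.2 fun z hz =>
      lt_or_gt_of_ne (f.norm_apply_ne_one (mem_ball_zero_iff.1 hz)))
    ⟨f.toFun y, Set.mem_image_of_mem _ (mem_ball_zero_iff.2 hy), hfy⟩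
  exact hsub (Set.mem_image_of_mem _ (mem_ball_zero_iff.2 hx))

theorem neg_one_le_apply_zero {x : Fin (j + 1) → ℝ} (hx : -1 ≤ x 0) : -1 ≤ f.toFun x 0 := by
  rcases lt_or_ge ‖x‖ 1 with h | h
  · have h1 := (norm_le_pi_norm (f.toFun x) 0).trans (f.norm_apply_lt_one h).le
    exact (abs_le.1 h1).1
  · rw [f.apply_of_one_le_norm h]
    simpa [stdIncl] using hx

theorem apply_zero_le_one {x : Fin (j + 1) → ℝ} (hx : x 0 ≤ 1) : f.toFun x 0 ≤ 1 := by
  rcases lt_or_ge ‖x‖ 1 with h | h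
  · have h1 := (norm_le_pi_norm (f.toFun x) 0).trans (f.norm_apply_lt_one h).le
    exact (abs_le.1 h1).2
  · rw [f.apply_of_one_le_norm h]
    simpa [stdIncl] using hx

end LongEmbedding

/-! ### Secants in the first coordinate direction -/

namespace LongEmbedding

variable {n j : ℕ} (f : LongEmbedding (n + 1) (j + 1)) (x : Fin (j + 1) → ℝ)

/-- The secant vector of `f` between the points of the line through `x` in direction `e₁` with
first coordinates `a` and `b`, that is, their difference quotient, extended to `a = b` by the
partial derivative. The definition as an integral covers both cases. -/
def secant (a b : ℝ) : Fin (n + 1) → ℝ :=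
  ∫ u in (0 : ℝ)..1, fderiv ℝ f.toFun (Function.update x 0 (a + u * (b - a))) (Pi.single 0 1)

theorem secant_self (a : ℝ) :
    f.secant x a a = fderiv ℝ f.toFun (Function.update x 0 a) (Pi.single 0 1) := by
  simp [secant]

theorem sub_smul_secant (a b : ℝ) :
    (b - a) • f.secant x a b =
      f.toFun (Function.update x 0 b) - f.toFun (Function.update x 0 a) := by
  rw [secant, ← intervalIntegral.integral_smul]
  have hd : ∀ u : ℝ, HasDerivAt (fun u : ℝ => f.toFun (Function.update x 0 (a + u * (b - a))))
      ((b - a) • fderiv ℝ f.toFun (Function.update x 0 (a + u * (b - a))) (Pi.single 0 1)) u := by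
    intro u
    have h1 : HasDerivAt (fun u : ℝ => a + u * (b - a)) (b - a) u := by
      simpa using ((hasDerivAt_id u).mul_const (b - a)).const_add a
    have h2 := ((hasDerivAt_update x 0 (a + u * (b - a))).scomp u h1)
    have h3 := (f.differentiable _).hasFDerivAt.comp_hasDerivAt u h2
    rw [map_smul] at h3
    exact h3
  rw [intervalIntegral.integral_eq_sub_of_hasDerivAt (fun u _ => hd u)]
  · simp
  · refine Continuous.intervalIntegrable ?_ _ _
    have h1 : Continuous fun u : ℝ => fderiv ℝ f.toFun (Function.update x 0 (a + u * (b - a))) :=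
      f.continuous_fderiv.comp (continuous_const.update 0 (by fun_prop))
    fun_prop

theorem secant_ne_zero (a b : ℝ) : f.secant x a b ≠ 0 := by
  intro h
  rcases eq_or_ne a b with rfl | hab
  · rw [secant_self] at h
    have := f.immersion _ (h.trans (map_zero _).symm)
    simp at this
  · have h1 := f.sub_smul_secant x a b
    rw [h, smul_zero, eq_comm, sub_eq_zero] at h1
    exact hab ((Function.update_injective x 0) (f.embedding.injective h1)).symm

theorem secant_of_fderiv_eq {a b : ℝ}
    (h : ∀ c, fderiv ℝ f.toFun (Function.update x 0 c) = stdInclL (n + 1) (j + 1)) :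
    f.secant x a b = Pi.single 0 1 := by
  simp [secant, h, coe_stdInclL, stdIncl_single_zero]

theorem fderiv_single_of_one_le_norm {x : Fin (j + 1) → ℝ} (hx : 1 ≤ ‖x‖) :
    fderiv ℝ f.toFun x (Pi.single 0 1) = Pi.single 0 1 := by
  rw [f.fderiv_of_one_le_norm hx, coe_stdInclL, stdIncl_single_zero]

theorem one_le_norm_update {c : ℝ} (hc : 1 ≤ |c|) : 1 ≤ ‖Function.update x 0 c‖ := by
  have := norm_le_pi_norm (Function.update x 0 c) 0
  rw [Function.update_self] at this
  exact hc.trans this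

/-- Since `f` maps the cube into the cube, secants from the left face of the cube point to the
right. -/
theorem secant_neg_one_apply_zero_nonneg {b : ℝ} (hb : -1 ≤ b) : 0 ≤ f.secant x (-1) b 0 := by
  rcases hb.eq_or_lt with rfl | hb'
  · rw [secant_self, f.fderiv_single_of_one_le_norm (one_le_norm_update x (by simp))]
    simp
  · have h1 := congrFun (f.sub_smul_secant x (-1) b) 0
    rw [Pi.sub_apply, f.apply_of_one_le_norm (one_le_norm_update x (c := -1) (by simp))] at h1
    have h2 := f.neg_one_le_apply_zero (x := Function.update x 0 b) (by simpa using hb)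
    simp only [Pi.smul_apply, smul_eq_mul] at h1
    have h3 : stdIncl (n + 1) (j + 1) (Function.update x 0 (-1)) 0 = -1 := by simp [stdIncl]
    rw [h3] at h1
    by_contra hcon
    nlinarith [mul_neg_of_pos_of_neg (sub_pos.2 hb') (not_le.1 hcon)]

theorem secant_one_apply_zero_nonneg {a : ℝ} (ha : a ≤ 1) : 0 ≤ f.secant x a 1 0 := by
  rcases ha.eq_or_lt with rfl | ha'
  · rw [secant_self, f.fderiv_single_of_one_le_norm (one_le_norm_update x (by simp))]
    simp
  · have h1 := congrFun (f.sub_smul_secant x a 1) 0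
    rw [Pi.sub_apply, f.apply_of_one_le_norm (one_le_norm_update x (c := 1) (by simp))] at h1
    have h2 := f.apply_zero_le_one (x := Function.update x 0 a) (by simpa using ha)
    simp only [Pi.smul_apply, smul_eq_mul] at h1
    have h3 : stdIncl (n + 1) (j + 1) (Function.update x 0 1) 0 = 1 := by simp [stdIncl]
    rw [h3] at h1
    by_contra hcon
    nlinarith [mul_neg_of_pos_of_neg (sub_pos.2 ha') (not_le.1 hcon)]

end LongEmbedding

theorem continuous_frame {n j : ℕ} (h : j ≤ n) :
    Continuous fun p : LongEmbedding n j × (Fin j → ℝ) => p.1.frame p.2 := by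
  have h1 : Continuous fun p : LongEmbedding n j × (Fin j → ℝ) =>
      ((smaleHirsch h p.1).1, p.2) :=
    (continuous_subtype_val.comp ((smaleHirsch h).continuous.comp continuous_fst)).prodMk
      continuous_snd
  exact ContinuousEval.continuous_eval.comp h1

theorem continuous_secant {n j : ℕ} (h : j ≤ n) :
    Continuous fun p : LongEmbedding (n + 1) (j + 1) × (Fin (j + 1) → ℝ) × ℝ × ℝ =>
      p.1.secant p.2.1 p.2.2.1 p.2.2.2 := by
  refine intervalIntegral.continuous_parametric_intervalIntegral_of_continuous' ?_ 0 1
  have h1 : Continuous fun q :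
      (LongEmbedding (n + 1) (j + 1) × (Fin (j + 1) → ℝ) × ℝ × ℝ) × ℝ =>
      (q.1.1, Function.update q.1.2.1 0 (q.1.2.2.1 + q.2 * (q.1.2.2.2 - q.1.2.2.1))) :=
    Continuous.prodMk (by fun_prop) (Continuous.update (by fun_prop) 0 (by fun_prop))
  exact (continuous_apply 0).comp (continuous_subtype_val.comp
    ((continuous_frame (Nat.add_le_add_right h 1)).comp h1))

/-! ### The null-homotopy of the first partial derivative -/

/-- The point of `[-1,1]` closest to `t`. -/
def clamp (t : ℝ) : ℝ := max (-1) (min 1 t)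

theorem clamp_of_le {t : ℝ} (ht : |t| ≤ 1) : clamp t = t := by
  rw [clamp, min_eq_right (abs_le.1 ht).2, max_eq_right (abs_le.1 ht).1]

theorem clamp_mem (t : ℝ) : -1 ≤ clamp t ∧ clamp t ≤ 1 :=
  ⟨le_max_left _ _, max_le (by norm_num) (min_le_left _ _)⟩

theorem clamp_of_one_le {t : ℝ} (ht : 1 ≤ |t|) : clamp t = 1 ∨ clamp t = -1 := by
  rcases le_abs.1 ht with h | h
  · left
    rw [clamp, min_eq_left h]
    norm_num
  · right
    rw [clamp, max_eq_left ((min_le_right _ _).trans (by linarith))]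

/-- The left endpoint of the secant at time `τ`, moving from `c` towards `-1`; it does not move for
`c = -1` and for `c = 1`. -/
def leftEnd (τ c : ℝ) : ℝ := max (-1) (c - τ * (1 - c))

/-- The right endpoint of the secant at time `τ`, moving from `c` towards `1`; it does not move for
`c = -1` and for `c = 1`. -/
def rightEnd (τ c : ℝ) : ℝ := min 1 (c + τ * (1 + c))

theorem leftEnd_zero {c : ℝ} (hc : -1 ≤ c) : leftEnd 0 c = c := by simp [leftEnd, hc]

theorem rightEnd_zero {c : ℝ} (hc : c ≤ 1) : rightEnd 0 c = c := by simp [rightEnd, hc]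

namespace LongEmbedding

variable {n j : ℕ} (f : LongEmbedding (n + 1) (j + 1)) (x : Fin (j + 1) → ℝ)

/-- A path of nonzero vectors from `∂f/∂x₁ (x)` to `e₁`. For `s ≤ 1/2` it consists of secants, the
last of which has an endpoint on the face `x₁ = -1` or on the face `x₁ = 1` of the cube; for
`s ≥ 1/2` it is a segment. -/
def secantPath (s : ℝ) : Fin (n + 1) → ℝ :=
  (1 - max 0 (2 * s - 1)) • f.secant x (leftEnd (min 1 (2 * s)) (clamp (x 0)))
      (rightEnd (min 1 (2 * s)) (clamp (x 0))) +
    max 0 (2 * s - 1) • Pi.single 0 1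

theorem secantPath_eq_single {s : ℝ} (hs : 0 ≤ s) (h : ∀ τ, 0 ≤ τ →
      f.secant x (leftEnd τ (clamp (x 0))) (rightEnd τ (clamp (x 0))) = Pi.single 0 1) :
    f.secantPath x s = Pi.single 0 1 := by
  rw [secantPath, h _ (le_min zero_le_one (by positivity)), ← add_smul, sub_add_cancel, one_smul]

theorem secantPath_of_notMem_cube (hx : x ∉ cube (j + 1)) {s : ℝ} (hs : 0 ≤ s) :
    f.secantPath x s = Pi.single 0 1 := by
  refine f.secantPath_eq_single x hs fun τ hτ => ?_
  rcases le_total 1 |x 0| with h0 | h0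
  · -- The endpoints of the secant stay at the same point of one of the faces `x₁ = ± 1`.
    have hdiag : ∀ c : ℝ, 1 ≤ |c| → f.secant x c c = Pi.single 0 1 := fun c hc => by
      rw [secant_self, f.fderiv_single_of_one_le_norm (one_le_norm_update x hc)]
    rcases clamp_of_one_le h0 with hc | hc
    · have h1 : leftEnd τ 1 = 1 := by norm_num [leftEnd]
      have h2 : rightEnd τ 1 = 1 := min_eq_left (by linarith)
      rw [hc, h1, h2, hdiag 1 (by simp)]
    · have h1 : leftEnd τ (-1) = -1 := max_eq_left (by linarith)
      have h2 : rightEnd τ (-1) = -1 := by norm_num [rightEnd]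
      rw [hc, h1, h2, hdiag (-1) (by simp)]
  · have hnorm : ∀ c, 1 ≤ ‖Function.update x 0 c‖ := by
      intro c
      have hx' : ¬ ‖x‖ ≤ 1 := fun h => hx (mem_cube_iff_norm.2 h)
      rw [pi_norm_le_iff_of_nonneg zero_le_one] at hx'
      push Not at hx'
      obtain ⟨i, hi⟩ := hx'
      have hi0 : i ≠ 0 := by
        rintro rfl
        exact absurd h0 (not_le.2 hi)
      have := norm_le_pi_norm (Function.update x 0 c) i
      rw [Function.update_of_ne hi0] at this
      exact hi.le.trans this
    exact f.secant_of_fderiv_eq x fun c => f.fderiv_of_one_le_norm (hnorm c)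

theorem secantPath_zero : f.secantPath x 0 = fderiv ℝ f.toFun x (Pi.single 0 1) := by
  have h : f.secantPath x 0 =
      fderiv ℝ f.toFun (Function.update x 0 (clamp (x 0))) (Pi.single 0 1) := by
    simp [secantPath, leftEnd_zero (clamp_mem _).1, rightEnd_zero (clamp_mem _).2, secant_self]
  rcases le_total 1 |x 0| with h0 | h0
  · have hx : 1 ≤ ‖x‖ := h0.trans (norm_le_pi_norm x 0)
    have hc : 1 ≤ |clamp (x 0)| := by rcases clamp_of_one_le h0 with hc | hc <;> simp [hc]
    rw [h, f.fderiv_single_of_one_le_norm hx,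
      f.fderiv_single_of_one_le_norm (one_le_norm_update x hc)]
  · rw [h, clamp_of_le h0, Function.update_eq_self]

theorem secantPath_one : f.secantPath x 1 = Pi.single 0 1 := by
  norm_num [secantPath]

theorem secantPath_ne_zero {s : ℝ} (hs : s ≤ 1) : f.secantPath x s ≠ 0 := by
  rcases le_total (2 * s) 1 with h | h
  · rw [secantPath, max_eq_left (by linarith)]
    simpa using f.secant_ne_zero x _ _
  · -- The secant has an endpoint on the boundary, so its first coordinate is nonnegative.
    set c := clamp (x 0)
    have hcm := clamp_mem (x 0)
    have hsec : 0 ≤ f.secant x (leftEnd 1 c) (rightEnd 1 c) 0 := by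
      rcases le_total c 0 with h0 | h0
      · have h1 : leftEnd 1 c = -1 := max_eq_left (by linarith)
        rw [h1]
        exact f.secant_neg_one_apply_zero_nonneg x (le_min (by norm_num) (by linarith))
      · have h1 : rightEnd 1 c = 1 := min_eq_left (by linarith)
        rw [h1]
        exact f.secant_one_apply_zero_nonneg x (max_le (by norm_num) (by linarith))
    intro hzero
    rw [secantPath, min_eq_left h, max_eq_right (by linarith)] at hzero
    have h0 := congrFun hzero 0
    simp only [Pi.add_apply, Pi.smul_apply, smul_eq_mul, Pi.single_eq_same, mul_one,
      Pi.zero_apply] at h0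
    have h2 : 0 ≤ (1 - (2 * s - 1)) * f.secant x (leftEnd 1 c) (rightEnd 1 c) 0 :=
      mul_nonneg (by linarith) hsec
    have h3 : 2 * s - 1 = 0 := by linarith
    rw [h3] at hzero
    exact f.secant_ne_zero x _ _ (by simpa using hzero)

theorem secantPath_std (h : j ≤ n) {s : ℝ} (hs : 0 ≤ s) :
    (std (Nat.add_le_add_right h 1)).secantPath x s = Pi.single 0 1 :=
  secantPath_eq_single _ x hs fun _ _ => secant_of_fderiv_eq _ x fun _ =>
    (stdInclL (n + 1) (j + 1)).fderiv

end LongEmbedding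

theorem continuous_secantPath {n j : ℕ} (h : j ≤ n) :
    Continuous fun p : (LongEmbedding (n + 1) (j + 1) × (Fin (j + 1) → ℝ)) × ℝ =>
      p.1.1.secantPath p.1.2 p.2 := by
  have h1 : Continuous fun p : (LongEmbedding (n + 1) (j + 1) × (Fin (j + 1) → ℝ)) × ℝ =>
      (p.1.1, p.1.2, leftEnd (min 1 (2 * p.2)) (clamp (p.1.2 0)),
        rightEnd (min 1 (2 * p.2)) (clamp (p.1.2 0))) := by
    unfold leftEnd rightEnd clamp
    fun_prop
  have h2 := (continuous_secant h).comp h1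
  have h3 : Continuous fun p : (LongEmbedding (n + 1) (j + 1) × (Fin (j + 1) → ℝ)) × ℝ =>
      max 0 (2 * p.2 - 1) := by fun_prop
  exact ((continuous_const.sub h3).smul h2).add (h3.smul continuous_const)

/-! ### Frames with first vector `e₁` -/

section straighten

variable {n j : ℕ}

/-- The frame obtained from a frame with first vector `e₁` by subtracting from each further vector
`r` times its component along `e₁`. -/
def straighten (v : Stiefel (n + 1) (j + 1)) (hv : v.1 0 = Pi.single 0 1) (r : ℝ) :
    Stiefel (n + 1) (j + 1) :=
  ⟨Fin.cons (Pi.single 0 1) fun k => v.1 k.succ - (r * v.1 k.succ 0) • Pi.single 0 1, by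
    rw [Fintype.linearIndependent_iff]
    intro c hc
    rw [Fin.sum_univ_succ] at hc
    simp only [Fin.cons_zero, Fin.cons_succ, smul_sub, Finset.sum_sub_distrib, smul_smul,
      ← Finset.sum_smul] at hc
    have key := Fintype.linearIndependent_iff.1 v.2
      (Fin.cons (c 0 - ∑ k : Fin j, c k.succ * (r * v.1 k.succ 0)) fun k => c k.succ) (by
        rw [Fin.sum_univ_succ]
        simp only [Fin.cons_zero, Fin.cons_succ, hv]
        rw [sub_smul, ← hc]
        abel)
    have hs : ∀ k : Fin j, c k.succ = 0 := fun k => by simpa using key k.succ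
    have h0 : c 0 = 0 := by simpa [hs] using key 0
    exact fun k => Fin.cases h0 hs k⟩

/-- The frame in `ℝⁿ` formed by the projections of the further vectors of a frame in `ℝⁿ⁺¹` with
first vector `e₁`. -/
def tailFrame (v : Stiefel (n + 1) (j + 1)) (hv : v.1 0 = Pi.single 0 1) : Stiefel n j :=
  ⟨fun k i => v.1 k.succ i.succ, by
    rw [Fintype.linearIndependent_iff]
    intro c hc
    have hind := (straighten v hv 1).2
    have key := Fintype.linearIndependent_iff.1 hind (Fin.cons 0 c) (by
      rw [Fin.sum_univ_succ]
      funext i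
      refine Fin.cases ?_ (fun i => ?_) i
      · simp [straighten]
      · simpa [straighten] using congrFun hc i)
    exact fun k => by simpa using key k.succ⟩

theorem straighten_zero (v : Stiefel (n + 1) (j + 1)) (hv : v.1 0 = Pi.single 0 1) :
    straighten v hv 0 = v := by
  apply Subtype.ext
  funext k
  refine Fin.cases ?_ (fun k => ?_) k
  · simp [straighten, hv]
  · simp [straighten]

theorem straighten_one (v : Stiefel (n + 1) (j + 1)) (hv : v.1 0 = Pi.single 0 1) :
    straighten v hv 1 = fibreIncl n j (tailFrame v hv) := by
  apply Subtype.ext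
  funext k
  refine Fin.cases rfl (fun k => ?_) k
  funext i
  refine Fin.cases ?_ (fun i => ?_) i
  · simp [straighten, fibreIncl]
  · simp [straighten, fibreIncl, tailFrame]

theorem straighten_fibreIncl (v : Stiefel n j) (hv : (fibreIncl n j v).1 0 = Pi.single 0 1)
    (r : ℝ) : straighten (fibreIncl n j v) hv r = fibreIncl n j v := by
  apply Subtype.ext
  funext k
  refine Fin.cases rfl (fun k => ?_) k
  simp [straighten, fibreIncl]

theorem tailFrame_fibreIncl (v : Stiefel n j) (hv : (fibreIncl n j v).1 0 = Pi.single 0 1) :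
    tailFrame (fibreIncl n j v) hv = v := by
  apply Subtype.ext
  funext k i
  simp [tailFrame, fibreIncl]

theorem continuous_straighten {Z : Type*} [TopologicalSpace Z] {v : Z → Stiefel (n + 1) (j + 1)}
    (hv : Continuous v) (hv0 : ∀ z, (v z).1 0 = Pi.single 0 1) {r : Z → ℝ} (hr : Continuous r) :
    Continuous fun z => straighten (v z) (hv0 z) (r z) := by
  refine Continuous.subtype_mk (continuous_pi fun k => ?_) _
  have hv' (k) : Continuous fun z => (v z).1 k :=
    (continuous_apply k).comp (continuous_subtype_val.comp hv)
  have hv'' (k i) : Continuous fun z => (v z).1 k i := (continuous_apply i).comp (hv' k)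
  refine Fin.cases ?_ (fun k => ?_) k
  · simpa using continuous_const
  · simp only [Fin.cons_succ]
    exact (hv' _).sub ((hr.mul (hv'' _ _)).smul continuous_const)

theorem continuous_tailFrame {Z : Type*} [TopologicalSpace Z] {v : Z → Stiefel (n + 1) (j + 1)}
    (hv : Continuous v) (hv0 : ∀ z, (v z).1 0 = Pi.single 0 1) :
    Continuous fun z => tailFrame (v z) (hv0 z) := by
  refine Continuous.subtype_mk ?_ _
  exact continuous_pi fun k => continuous_pi fun i => (continuous_apply _).comp
    ((continuous_apply _).comp (continuous_subtype_val.comp hv))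

end straighten

/-! ### The factorization -/

/-- A continuous family of loops, as a continuous map into the loop space. -/
def loopFamily {A X : Type} [TopologicalSpace A] [TopologicalSpace X] {j : ℕ} {x₀ : X}
    (H : C(A × (Fin j → ℝ), X)) (hH : ∀ a, ∀ t ∉ cube j, H (a, t) = x₀) :
    C(A, LoopSpace j X x₀) where
  toFun a := ⟨H.curry a, hH a⟩
  continuous_toFun := H.curry.continuous.subtype_mk _

/-- Maps into a loop space are homotopic if they are joined by a continuous family of loops. -/
theorem homotopicRel_of_family {A X : Type} [TopologicalSpace A] [TopologicalSpace X] {j : ℕ}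
    {x₀ : X} {φ ψ : C(A, LoopSpace j X x₀)} {S : Set A}
    {H : (A × (Fin j → ℝ)) × unitInterval → X} (hH : Continuous H)
    (hbase : ∀ a, ∀ t ∉ cube j, ∀ s, H ((a, t), s) = x₀)
    (h0 : ∀ a t, H ((a, t), 0) = (φ a).1 t) (h1 : ∀ a t, H ((a, t), 1) = (ψ a).1 t)
    (hS : ∀ a ∈ S, ∀ t s, H ((a, t), s) = (φ a).1 t) : φ.HomotopicRel ψ S := by
  let H' : C((unitInterval × A) × (Fin j → ℝ), X) :=
    ⟨fun p => H ((p.1.2, p.2), p.1.1), hH.comp (by fun_prop)⟩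
  exact ⟨{
    toContinuousMap := loopFamily H' fun a t ht => hbase a.2 t ht a.1
    map_zero_left := fun a => Subtype.ext (ContinuousMap.ext (h0 a))
    map_one_left := fun a => Subtype.ext (ContinuousMap.ext (h1 a))
    prop' := fun s a ha => Subtype.ext (ContinuousMap.ext fun t => hS a ha t s) }⟩

theorem exists_smaleHirsch_factorization (n j : ℕ) (h : j ≤ n) :
    ∃ g : C(LongEmbedding (n + 1) (j + 1), LoopSpace (j + 1) (Stiefel n j) (stdFrame h)),
      g (LongEmbedding.std (Nat.add_le_add_right h 1)) = constLoop (j + 1) (stdFrame h) ∧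
      ContinuousMap.HomotopicRel (smaleHirsch (Nat.add_le_add_right h 1))
        ((loopMap (j + 1) (fibreIncl n j) (fibreIncl_stdFrame h)).comp g)
        {LongEmbedding.std (Nat.add_le_add_right h 1)} := by
  let h' := Nat.add_le_add_right h 1
  obtain ⟨G, hG, hG0, hGw, hGc⟩ := exists_frame_lift (continuous_secantPath h)
    (fun z t ht => z.1.secantPath_ne_zero z.2 ht.2) (continuous_frame h')
    (fun z => (z.1.secantPath_zero z.2).symm)
  have hone : ∀ z, (G (z, 1)).1 0 = Pi.single 0 1 := fun z => by
    rw [hGw]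
    exact z.1.secantPath_one z.2
  -- The lift is constant outside the cube, and on the standard embedding.
  have hout : ∀ f, ∀ t ∉ cube (j + 1), ∀ s, G ((f, t), s) = stdFrame h' := fun f t ht s =>
    (hGc (f, t) (fun r hr => (f.secantPath_of_notMem_cube t ht hr.1).trans
      (f.secantPath_of_notMem_cube t ht le_rfl).symm) s).trans ((f.frameLoop h').2 t ht)
  have hstd : ∀ t s, G ((LongEmbedding.std h', t), s) = stdFrame h' := fun t s =>
    (hGc (LongEmbedding.std h', t) (fun r hr => (LongEmbedding.secantPath_std t h hr.1).trans
      (LongEmbedding.secantPath_std t h le_rfl).symm) s).trans (by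
        apply Subtype.ext
        funext k
        exact congrArg (· (Pi.single k 1)) (stdInclL (n + 1) (j + 1)).fderiv)
  have htail : ∀ z, G (z, 1) = stdFrame h' → tailFrame (G (z, 1)) (hone z) = stdFrame h := by
    intro z hz
    have key : ∀ v (hv : v.1 0 = Pi.single 0 1), v = stdFrame h' →
        tailFrame v hv = stdFrame h := by
      rintro _ hv rfl
      simp only [← fibreIncl_stdFrame h, tailFrame_fibreIncl]
    exact key _ _ hz
  have hstraight : ∀ z r, G (z, 1) = stdFrame h' →
      straighten (G (z, 1)) (hone z) r = stdFrame h' := by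
    intro z r hz
    have key : ∀ v (hv : v.1 0 = Pi.single 0 1), v = stdFrame h' →
        straighten v hv r = stdFrame h' := by
      rintro _ hv rfl
      simp only [← fibreIncl_stdFrame h, straighten_fibreIncl]
    exact key _ _ hz
  have hG1 : Continuous fun z => G (z, 1) := hG.comp (by fun_prop)
  let g := loopFamily ⟨fun z => tailFrame (G (z, 1)) (hone z), continuous_tailFrame hG1 hone⟩
    fun f t ht => htail (f, t) (hout f t ht 1)
  let mid := loopFamily ⟨fun z => G (z, 1), hG1⟩ fun f t ht => hout f t ht 1
  refine ⟨g, Subtype.ext (ContinuousMap.ext fun t => htail _ (hstd t 1)), ?_⟩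
  have hfirst : ContinuousMap.HomotopicRel (smaleHirsch h') mid {LongEmbedding.std h'} := by
    refine homotopicRel_of_family hG hout (fun f t => hG0 (f, t)) (fun f t => rfl) ?_
    rintro _ rfl t s
    exact (hstd t s).trans ((hstd t 0).symm.trans (hG0 _))
  refine hfirst.trans (homotopicRel_of_family
    (H := fun p => straighten (G (p.1, 1)) (hone p.1) p.2)
    (continuous_straighten (hG1.comp continuous_fst) (fun p => hone p.1) (by fun_prop))
    (fun f t ht s => hstraight _ _ (hout f t ht 1)) (fun f t => straighten_zero _ _)
    (fun f t => straighten_one _ _) ?_)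
  rintro _ rfl t s
  exact (hstraight _ _ (hstd t 1)).trans (hstd t 1).symm

end

end SmaleHirsch

theorem theorem2p5 (n j : ℕ) (h : j ≤ n) :
    (∃ g : C(SmaleHirsch.LongEmbedding (n + 1) (j + 1),
        SmaleHirsch.LoopSpace (j + 1) (SmaleHirsch.Stiefel n j) (SmaleHirsch.stdFrame h)),
      g (SmaleHirsch.LongEmbedding.std (Nat.add_le_add_right h 1)) =
          SmaleHirsch.constLoop (j + 1) (SmaleHirsch.stdFrame h) ∧
      ContinuousMap.HomotopicRel
        (SmaleHirsch.smaleHirsch (Nat.add_le_add_right h 1))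
        ((SmaleHirsch.loopMap (j + 1) (SmaleHirsch.fibreIncl n j)
          (SmaleHirsch.fibreIncl_stdFrame h)).comp g)
        {SmaleHirsch.LongEmbedding.std (Nat.add_le_add_right h 1)}) ∧
    (j = 0 →
      ContinuousMap.HomotopicRel
        (SmaleHirsch.smaleHirsch (Nat.add_le_add_right h 1))
        (ContinuousMap.const _
          (SmaleHirsch.constLoop (j + 1) (SmaleHirsch.stdFrame (Nat.add_le_add_right h 1))))
        {SmaleHirsch.LongEmbedding.std (Nat.add_le_add_right h 1)}) := by
  obtain ⟨g, hg, hom⟩ := SmaleHirsch.exists_smaleHirsch_factorization n j h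
  refine ⟨⟨g, hg, hom⟩, ?_⟩
  rintro rfl
  -- The Stiefel manifold of empty frames is a point, so `g` is constant.
  have hconst : (SmaleHirsch.loopMap 1 (SmaleHirsch.fibreIncl n 0)
      (SmaleHirsch.fibreIncl_stdFrame h)).comp g = ContinuousMap.const _
        (SmaleHirsch.constLoop 1 (SmaleHirsch.stdFrame (Nat.add_le_add_right h 1))) := by
    refine ContinuousMap.ext fun f => Subtype.ext (ContinuousMap.ext fun t => ?_)
    have hv : (g f).1 t = SmaleHirsch.stdFrame h := Subtype.ext (Subsingleton.elim _ _)
    exact (congrArg (SmaleHirsch.fibreIncl n 0) hv).trans (SmaleHirsch.fibreIncl_stdFrame h)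
  exact hconst ▸ hom
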